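/- Let $K$ be a field, let $S=K[t_1,\ldots,t_s]$ be a polynomial ring with the standard grading, let $\prec$ be a monomial order on $S$, and let $\mathbb{X}=\{[P_1],\ldots,[P_m]\}$ be a finite set of $m\ge 2$ points of the projective space $\mathbb{P}^{s-1}$ over $K$, with representatives $P_i\in K^s\setminus\{0\}$ chosen in any way. Let $I=I(\mathbb{X})\subset S$ be the vanishing ideal of $\mathbb{X}$, generated by the homogeneous polynomials that vanish at all points of $\mathbb{X}$. For a graded ideal $J\subset S$, put $H_J(d)=\dim_K(S_d/(J\cap S_d))$ and let $\deg(S/J)$ be the degree (multiplicity) of $S/J$: with $k$ the Krull dimension of $S/J$, it is $(k-1)!\lim_{d\to\infty}H_J(d)/d^{k-1}$ if $k\ge 1$, and $\dim_K(S/J)$ if $k=0$. Let ${\rm in}_\prec(I)$ be the initial ideal of $I$. For integers $d,r\ge 1$ let $\mathcal{M}_{\prec,d,r}$ be the set of all sets $M$ of $r$ distinct monomials of degree $d$, none of them in ${\rm in}_\prec(I)$, such that $({\rm in}_\prec(I)\colon(M))\ne{\rm in}_\prec(I)$. The generalized footprint function of $I$ is $${\rm fp}_I(d,r)=\begin{cases}\deg(S/I)-\max\{\deg(S/({\rm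 in}_\prec(I),M)) : M\in\mathcal{M}_{\prec,d,r}\}&\text{if }\mathcal{M}_{\prec,d,r}\ne\emptyset,\\ \deg(S/I)&\text{if }\mathcal{M}_{\prec,d,r}=\emptyset.\end{cases}$$ Let $C_{\mathbb{X}}(d)\subset K^m$ be the image of $S_d$ under $f\mapsto(f(P_1),\ldots,f(P_m))$, and let $\delta_{\mathbb{X}}(d,r)$ be its $r$-th generalized Hamming weight, that is, the least value of $|\chi(D)|$ over all $r$-dimensional linear subspaces $D$ of $C_{\mathbb{X}}(d)$, where $\chi(D)=\{i : a_i\ne 0\text{ for some }(a_1,\ldots,a_m)\in D\}$. Then $${\rm fp}_{I(\mathbb{X})}(d,r)\le\delta_{\mathbb{X}}(d,r)\quad\text{for all } d\ge 1\text{ and }1\le r\le H_{I(\mathbb{X})}(d).$$ -/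

import Mathlib

open scoped LinearAlgebra.Projectivization

noncomputable section

namespace FootprintBound

/-! `MvPolynomial (Fin s) K` is the polynomial ring `S = K[t₁, …, tₛ]` with its standard grading. -/

/-- The Hilbert function `H_I(d) = dim_K (S_d / I_d)` of `S/I`, where `I_d = I ∩ S_d`. -/
def hilbertFn {s : ℕ} {K : Type*} [Field K] (I : Ideal (MvPolynomial (Fin s) K)) (d : ℕ) : ℕ :=
  Module.finrank K
    (MvPolynomial.homogeneousSubmodule (Fin s) K d ⧸
      (I.restrictScalars K).comap (MvPolynomial.homogeneousSubmodule (Fin s) K d).subtype)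

/-- The Krull dimension of `S/I` as a natural number (`0` for the zero ring). -/
def krullDim {s : ℕ} {K : Type*} [Field K] (I : Ideal (MvPolynomial (Fin s) K)) : ℕ :=
  ((ringKrullDim (MvPolynomial (Fin s) K ⧸ I)).unbotD 0).toNat

/-- The degree (multiplicity) of `S/I` for a graded ideal `I`: with `k = dim (S/I)`, it is
`(k-1)! lim_{d → ∞} H_I(d) / d^(k-1)` if `k ≥ 1`, and `dim_K (S/I)` if `k = 0`.
The limit exists for every graded ideal `I` by Hilbert's theorem. -/
def deg {s : ℕ} {K : Type*} [Field K] (I : Ideal (MvPolynomial (Fin s) K)) : ℝ :=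
  if 1 ≤ krullDim I then
    (Nat.factorial (krullDim I - 1) : ℝ) *
      Filter.limUnder Filter.atTop
        (fun d : ℕ => (hilbertFn I d : ℝ) / (d : ℝ) ^ (krullDim I - 1))
  else (Module.finrank K (MvPolynomial (Fin s) K ⧸ I) : ℝ)

/-- The initial ideal of `I`, generated by the leading monomials of the nonzero `f ∈ I`. -/
def initialIdeal {s : ℕ} {K : Type*} [Field K] (m : MonomialOrder (Fin s))
    (I : Ideal (MvPolynomial (Fin s) K)) : Ideal (MvPolynomial (Fin s) K) :=
  Ideal.span {g | ∃ f ∈ I, f ≠ 0 ∧ g = MvPolynomial.monomial (m.degree f) 1}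

/-- The footprint `Δ(I)`: the (exponents of the) standard monomials of `S/I`. -/
def footprint {s : ℕ} {K : Type*} [Field K] (m : MonomialOrder (Fin s))
    (I : Ideal (MvPolynomial (Fin s) K)) : Set (Fin s →₀ ℕ) :=
  {a | MvPolynomial.monomial a (1 : K) ∉ initialIdeal m I}

/-- The ideal `(M)` generated by the monomials with exponents in `M`. -/
def monomialIdeal {s : ℕ} (K : Type*) [Field K] (M : Finset (Fin s →₀ ℕ)) :
    Ideal (MvPolynomial (Fin s) K) :=
  Ideal.span ((fun a => MvPolynomial.monomial a (1 : K)) '' (M : Set (Fin s →₀ ℕ)))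

/-- The family of all sets `M` of `r` distinct standard monomials of degree `d` with
`(in(I) : (M)) ≠ in(I)`. -/
def footprintSets {s : ℕ} {K : Type*} [Field K] (m : MonomialOrder (Fin s))
    (I : Ideal (MvPolynomial (Fin s) K)) (d r : ℕ) : Set (Finset (Fin s →₀ ℕ)) :=
  {M | M.card = r ∧ (∀ a ∈ M, a ∈ footprint m I ∧ a.degree = d) ∧
    (initialIdeal m I).colon (monomialIdeal K M : Set (MvPolynomial (Fin s) K)) ≠
      initialIdeal m I}

/-- The family is finite, so that the supremum in `fp` below is a maximum. -/
theorem footprintSets_finite {s : ℕ} {K : Type*} [Field K] (m : MonomialOrder (Fin s))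
    (I : Ideal (MvPolynomial (Fin s) K)) (d r : ℕ) : (footprintSets m I d r).Finite := by
  have h : {a : Fin s →₀ ℕ | a.degree ≤ d}.Finite := Finsupp.finite_of_degree_le d
  refine (h.toFinset.powerset.finite_toSet).subset ?_
  intro M hM
  simp only [Finset.coe_powerset, Set.mem_preimage, Set.mem_powerset_iff]
  intro a ha
  simpa using (hM.2.1 a ha).2.le

open Classical in
/-- The generalized footprint function of `I`:
`fp_I(d,r) = deg(S/I) - max {deg(S/(in(I), M))}`, where `M` ranges over `footprintSets m I d r`,
if this family is nonempty, and `fp_I(d,r) = deg(S/I)` otherwise. -/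
def fp {s : ℕ} {K : Type*} [Field K] (m : MonomialOrder (Fin s))
    (I : Ideal (MvPolynomial (Fin s) K)) (d r : ℕ) : ℝ :=
  if (footprintSets m I d r).Nonempty then
    deg I - sSup ((fun M => deg (initialIdeal m I ⊔ monomialIdeal K M)) '' footprintSets m I d r)
  else deg I

/-- The vanishing ideal `I(X)`, generated by the homogeneous polynomials that vanish at all
points of `X`. -/
def vanishingIdeal {s : ℕ} {K : Type*} [Field K] (X : Set (ℙ K (Fin s → K))) :
    Ideal (MvPolynomial (Fin s) K) :=
  Ideal.span {f | (∃ d : ℕ, f.IsHomogeneous d) ∧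
    ∀ (α : Fin s → K) (hα : α ≠ 0), Projectivization.mk K α hα ∈ X → MvPolynomial.eval α f = 0}

/-- The evaluation map `S_d → K^X`, `f ↦ (f(P_i))_i`, where `v` lists the chosen
representatives `P_i` of the points of `X`. -/
def evalMap {s : ℕ} {K : Type*} [Field K] {ι : Type*} (v : ι → Fin s → K) (d : ℕ) :
    MvPolynomial.homogeneousSubmodule (Fin s) K d →ₗ[K] (ι → K) :=
  (LinearMap.pi fun i => (MvPolynomial.aeval (v i) :
    MvPolynomial (Fin s) K →ₐ[K] K).toLinearMap) ∘ₗ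
      (MvPolynomial.homogeneousSubmodule (Fin s) K d).subtype

/-- The projective Reed-Muller-type code of degree `d`: the image of the evaluation map. -/
def reedMullerCode {s : ℕ} {K : Type*} [Field K] {ι : Type*} (v : ι → Fin s → K) (d : ℕ) :
    Submodule K (ι → K) :=
  LinearMap.range (evalMap v d)

/-- The support `χ(D)` of a linear code: the set of its nonzero positions. -/
def supp {K : Type*} [Field K] {ι : Type*} (D : Submodule K (ι → K)) : Set ι :=
  {i | ∃ a ∈ D, a i ≠ 0}

/-- The `r`-th generalized Hamming weight of `C`: the least size of the support of an
`r`-dimensional subcode of `C`. (Such subcodes exist for `r ≤ dim C`.) -/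
def genHammingWeight {K : Type*} [Field K] {ι : Type*} (C : Submodule K (ι → K)) (r : ℕ) : ℕ :=
  sInf {n | ∃ D : Submodule K (ι → K), D ≤ C ∧ Module.finrank K D = r ∧ (supp D).ncard = n}

end FootprintBound

end

noncomputable section

namespace FootprintBound

/-! ### Lower sets of exponents with boundedly many elements in each degree -/

/-! Let `D` be an `r`-dimensional subcode of least support and `V` the set of points outside that
support. The forms of degree `d` whose codeword lies in `D` make up a space `G` containing `I_d`
with codimension `r`. Since a space of forms has as many leading exponents as its dimension, `G` has
`r` leading monomials that are standard for `I`; call them `M` (`exists_standard_leadExps`).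
Elements of `G` vanish on `V`, so `(in(I), M) ⊆ in(I(V))`, and by Macaulay's theorem the Hilbert
function of `S/(in(I), M)` is eventually at least `|V|`.

If `V` is nonempty, two facts about monomials remain. The Hilbert function of `in(I)` is bounded by
`|X|`, so standard monomials stay close to the coordinate axes; hence `S/(in(I), M)` has dimension 1
and degree at least `|V|` (`le_deg_span_monomial`). Some axis lies wholly outside `(in(I), M)`, and
moving far along it gives a standard `u` with `uM ⊆ in(I)`, which is the colon condition
(`exists_add_notMem`). As `deg(S/I) = |X|`, it follows that `fp ≤ |X| - |V|`, the weight of `D`. If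
`V` is empty, nonnegativity of the degrees suffices. -/

/-- The elements of degree `e` of a set of exponents. -/
def slice {s : ℕ} (Δ : Set (Fin s →₀ ℕ)) (e : ℕ) : Set (Fin s →₀ ℕ) :=
  {a | a ∈ Δ ∧ a.degree = e}

theorem slice_finite {s : ℕ} (Δ : Set (Fin s →₀ ℕ)) (e : ℕ) : (slice Δ e).Finite :=
  (Finsupp.finite_of_degree_le e).subset fun _ ha => ha.2.le

theorem slice_mono {s : ℕ} {Δ Δ' : Set (Fin s →₀ ℕ)} (h : Δ ⊆ Δ') (e : ℕ) :
    slice Δ e ⊆ slice Δ' e :=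
  fun _ ha => ⟨h ha.1, ha.2⟩

/-- With two coordinates `≥ n`, the lower set would contain the `n + 1` exponents of `t_i^p
t_j^(n-p)`, all of degree `n`. So at most one coordinate of an element is large. -/
theorem coord_lt_of_ncard_slice_le {s n : ℕ} {Δ : Set (Fin s →₀ ℕ)} (hΔ : IsLowerSet Δ)
    (hn : ∀ e, (slice Δ e).ncard ≤ n) {a : Fin s →₀ ℕ} (ha : a ∈ Δ) {i j : Fin s}
    (hij : i ≠ j) (hi : n ≤ a i) : a j < n := by
  by_contra! hj
  let f : ℕ → (Fin s →₀ ℕ) := fun p => Finsupp.single i p + Finsupp.single j (n - p)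
  have hf : Function.Injective f := by
    intro p q hpq
    have := DFunLike.congr_fun hpq i
    simpa [f, hij.symm, hij] using this
  have hsub : ((Finset.range (n + 1)).image f : Set (Fin s →₀ ℕ)) ⊆ slice Δ n := by
    intro b hb
    simp only [Finset.coe_image, Finset.coe_range, Set.mem_image, Set.mem_Iio] at hb
    obtain ⟨p, hp, rfl⟩ := hb
    refine ⟨hΔ (fun k => ?_) ha, ?_⟩
    · by_cases hki : k = i
      · subst hki
        simp [f, hij.symm]
        omega
      · by_cases hkj : k = j
        · subst hkj
          simp [f, hij]
          omega
        · simp [f, Ne.symm hki, Ne.symm hkj]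
    · simp only [f, map_add, Finsupp.degree_single]
      omega
  have h1 := Set.ncard_le_ncard hsub (slice_finite Δ n)
  rw [Set.ncard_coe_finset, Finset.card_image_of_injective _ hf, Finset.card_range] at h1
  have := hn n
  omega

theorem exists_le_coord {s n : ℕ} {a : Fin s →₀ ℕ} (h : s * n < a.degree) : ∃ i, n ≤ a i := by
  by_contra! hc
  rw [Finsupp.degree_eq_sum] at h
  have : ∑ i, a i ≤ ∑ _i : Fin s, n := Finset.sum_le_sum fun i _ => (hc i).le
  simp at this
  omega

/-- In large degree some variable has exponent `≥ n + 1`; divide by it. The quotient still has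
exponent `≥ n` there, and only one variable can, so the quotient determines the variable and the map
is injective. -/
theorem ncard_slice_succ_le {s n : ℕ} {Δ : Set (Fin s →₀ ℕ)} (hΔ : IsLowerSet Δ)
    (hn : ∀ e, (slice Δ e).ncard ≤ n) {e : ℕ} (he : s * (n + 1) ≤ e) :
    (slice Δ (e + 1)).ncard ≤ (slice Δ e).ncard := by
  have hex : ∀ a : Fin s →₀ ℕ, ∃ c, a ∈ slice Δ (e + 1) →
      c ∈ slice Δ e ∧ ∃ i, n ≤ c i ∧ a = c + Finsupp.single i 1 := by
    intro a
    by_cases ha : a ∈ slice Δ (e + 1)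
    · obtain ⟨i, hi⟩ := exists_le_coord (s := s) (n := n + 1) (a := a) (by rw [ha.2]; omega)
      have hle : Finsupp.single i 1 ≤ a := by
        rw [Finsupp.single_le_iff]
        omega
      have heq : a = (a - Finsupp.single i 1) + Finsupp.single i 1 :=
        (tsub_add_cancel_of_le hle).symm
      refine ⟨a - Finsupp.single i 1, fun _ => ⟨⟨hΔ tsub_le_self ha.1, ?_⟩, i, ?_, heq⟩⟩
      · have := congrArg Finsupp.degree heq
        rw [ha.2, map_add, Finsupp.degree_single] at this
        omega
      · simp
        omega
    · exact ⟨0, fun h => absurd h ha⟩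
  choose g hg using hex
  refine Set.ncard_le_ncard_of_injOn g (fun a ha => (hg a ha).1) ?_ (slice_finite Δ e)
  intro a ha b hb hab
  obtain ⟨hc, i, hi, hai⟩ := hg a ha
  obtain ⟨-, j, hj, hbj⟩ := hg b hb
  rw [← hab] at hj hbj
  have hij : i = j := by
    by_contra hij
    have := coord_lt_of_ncard_slice_le hΔ hn hc.1 hij hi
    omega
  rw [hai, hbj, hij]

theorem eventually_ncard_slice_eq {s n : ℕ} {Δ : Set (Fin s →₀ ℕ)} (hΔ : IsLowerSet Δ)
    (hn : ∀ e, (slice Δ e).ncard ≤ n) :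
    ∃ c, ∀ᶠ e in Filter.atTop, (slice Δ e).ncard = c := by
  let f : ℕ → ℕ := fun k => (slice Δ (s * (n + 1) + k)).ncard
  have hf : Antitone f := antitone_nat_of_succ_le fun k =>
    ncard_slice_succ_le hΔ hn (Nat.le_add_right _ _)
  obtain ⟨k, hk⟩ := Nat.sInf_mem (Set.range_nonempty f)
  refine ⟨sInf (Set.range f), Filter.eventually_atTop.2 ⟨s * (n + 1) + k, fun e he => ?_⟩⟩
  obtain ⟨l, rfl⟩ := Nat.exists_eq_add_of_le he
  have h1 : f (k + l) ≤ f k := hf (Nat.le_add_right _ _)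
  have h2 : sInf (Set.range f) ≤ f (k + l) := Nat.sInf_le ⟨_, rfl⟩
  rw [add_assoc]
  exact le_antisymm (hk ▸ h1) h2

/-- If every axis left `Δ` at some point, all coordinates of elements of `Δ` would be bounded, and
so would their degrees. -/
theorem exists_forall_single_mem {s : ℕ} {Δ : Set (Fin s →₀ ℕ)} (hΔ : IsLowerSet Δ)
    (h : ∀ᶠ e in Filter.atTop, (slice Δ e).Nonempty) : ∃ i, ∀ n, Finsupp.single i n ∈ Δ := by
  by_contra! hc
  choose k hk using hc
  obtain ⟨e, he, h1⟩ := (h.and (Filter.eventually_gt_atTop (s * Finset.univ.sup k))).exists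
  obtain ⟨a, ha⟩ := he
  obtain ⟨i, hi⟩ := exists_le_coord (a := a) (by rw [ha.2]; exact h1)
  refine hk i (hΔ ?_ ha.1)
  rw [Finsupp.single_le_iff]
  exact (Finset.le_sup (Finset.mem_univ i)).trans hi

/-- Take an exponent whose whole ray in direction `i` stays in `Δ` and whose degree in the other
variables is maximal. Each `a ∈ M` involves another variable, so adding it breaks the ray; a point
far enough along the ray works for all of `M` at once. -/
theorem exists_add_notMem {s n : ℕ} {Δ : Set (Fin s →₀ ℕ)} (hΔ : IsLowerSet Δ)
    (hn : ∀ e, (slice Δ e).ncard ≤ n) {i : Fin s} (hi : ∀ k, Finsupp.single i k ∈ Δ)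
    (M : Finset (Fin s →₀ ℕ)) (hM : ∀ a ∈ M, ∀ k, ¬ a ≤ Finsupp.single i k) :
    ∃ u ∈ Δ, ∀ a ∈ M, u + a ∉ Δ := by
  let w : (Fin s →₀ ℕ) → ℕ := fun b => ∑ j ∈ Finset.univ.erase i, b j
  let A : Set (Fin s →₀ ℕ) := {b | ∀ k, b + Finsupp.single i k ∈ Δ}
  have hw : ∀ b ∈ A, w b ≤ s * n := by
    intro b hb
    have h1 : ∀ j ∈ Finset.univ.erase i, b j ≤ n := by
      intro j hj
      have hji := Finset.ne_of_mem_erase hj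
      have := coord_lt_of_ncard_slice_le hΔ hn (hb n) hji.symm (by simp)
      simp [hji] at this
      omega
    calc w b ≤ ∑ _j ∈ Finset.univ.erase i, n := Finset.sum_le_sum h1
      _ ≤ s * n := by
        rw [Finset.sum_const, smul_eq_mul]
        refine Nat.mul_le_mul_right _ ((Finset.card_erase_le).trans ?_)
        simp
  have h0 : (0 : Fin s →₀ ℕ) ∈ A := fun k => by simpa using hi k
  have hbdd : BddAbove (w '' A) := ⟨s * n, by rintro _ ⟨b, hb, rfl⟩; exact hw b hb⟩
  obtain ⟨b, hbA, hb⟩ := Nat.sSup_mem (Set.Nonempty.image w ⟨0, h0⟩) hbdd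
  have hmax : ∀ c ∈ A, w c ≤ w b := fun c hc => hb ▸ le_csSup hbdd ⟨c, hc, rfl⟩
  have hnot : ∀ a ∈ M, b + a ∉ A := by
    intro a ha hA
    have hlt : 0 < w a := by
      by_contra! h
      refine hM a ha (a i) fun j => ?_
      by_cases hji : j = i
      · simp [hji]
      · have h2 : w a = 0 := by omega
        have := (Finset.sum_eq_zero_iff.1 h2) j (by simp [hji])
        simp [this]
    have := hmax _ hA
    have hadd : w (b + a) = w b + w a := by simp [w, Finset.sum_add_distrib]
    omega
  have hk : ∀ a, ∃ k, a ∈ M → b + a + Finsupp.single i k ∉ Δ := by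
    intro a
    by_cases ha : a ∈ M
    · have := hnot a ha
      simp only [A, Set.mem_ofPred_eq, not_forall] at this
      exact this.imp fun k h _ => h
    · exact ⟨0, fun h => absurd h ha⟩
  choose k hk using hk
  -- Past the largest of the exit points `k a`, every translate by `M` has already left `Δ`, because
  -- `Δ` is a lower set.
  refine ⟨b + Finsupp.single i (M.sup k), hbA _, fun a ha h => hk a ha (hΔ ?_ h)⟩
  have h1 : Finsupp.single i (k a) ≤ Finsupp.single i (M.sup k) :=
    Finsupp.single_mono (Finset.le_sup ha)
  calc b + a + Finsupp.single i (k a) ≤ b + a + Finsupp.single i (M.sup k) :=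
        add_le_add_right h1 _
    _ = b + Finsupp.single i (M.sup k) + a := by abel

open MvPolynomial

/-! ### Leading exponents and Hilbert functions -/

/-- The leading exponents of the nonzero elements of a space of polynomials. -/
def leadExps {s : ℕ} {K : Type*} [Field K] (m : MonomialOrder (Fin s))
    (U : Submodule K (MvPolynomial (Fin s) K)) : Set (Fin s →₀ ℕ) :=
  {a | ∃ f ∈ U, f ≠ 0 ∧ m.degree f = a}

theorem degree_leadingExp {s : ℕ} {K : Type*} [Field K] (m : MonomialOrder (Fin s)) {e : ℕ}
    {f : MvPolynomial (Fin s) K} (hf : f.IsHomogeneous e) (h0 : f ≠ 0) :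
    (m.degree f).degree = e := by
  by_contra h
  exact m.coeff_degree_ne_zero_iff.2 h0 (hf.coeff_eq_zero h)

instance finite_homogeneousSubmodule {s : ℕ} {K : Type*} [Field K] (e : ℕ) :
    Module.Finite K (homogeneousSubmodule (Fin s) K e) :=
  Module.Finite.iff_fg.2 (homogeneousSubmodule_fg (Fin s) K e)

theorem leadExps_finite {s : ℕ} {K : Type*} [Field K] (m : MonomialOrder (Fin s)) {e : ℕ}
    {U : Submodule K (MvPolynomial (Fin s) K)} (hU : U ≤ homogeneousSubmodule (Fin s) K e) :
    (leadExps m U).Finite := by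
  refine (Finsupp.finite_of_degree_le e).subset ?_
  rintro _ ⟨f, hf, h0, rfl⟩
  exact (degree_leadingExp m (hU hf) h0).le

/-- In a linear relation, the largest leading exponent among the terms with nonzero coefficient
cannot cancel. -/
theorem linearIndependent_of_degree_eq {s : ℕ} {K : Type*} [Field K]
    (m : MonomialOrder (Fin s)) {ι : Type*} (e : ι → Fin s →₀ ℕ) (he : Function.Injective e)
    (f : ι → MvPolynomial (Fin s) K) (h0 : ∀ i, f i ≠ 0) (hf : ∀ i, m.degree (f i) = e i) :
    LinearIndependent K f := by
  classical
  rw [linearIndependent_iff']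
  intro t g hg i hi
  by_contra hgi
  obtain ⟨j, hj, hmax⟩ := Finset.exists_max_image (t.filter fun i => g i ≠ 0)
    (fun i => m.toSyn (e i)) ⟨i, by simp [hi, hgi]⟩
  simp only [Finset.mem_filter] at hj hmax
  have hc := congrArg (coeff (e j)) hg
  rw [coeff_sum, Finset.sum_eq_single_of_mem j hj.1, coeff_smul, coeff_zero, smul_eq_mul,
    ← hf j] at hc
  · exact mul_ne_zero hj.2 (m.coeff_degree_ne_zero_iff.2 (h0 j)) hc
  · intro k hk hkj
    by_cases hgk : g k = 0
    · simp [hgk]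
    · have hlt : m.toSyn (m.degree (f k)) < m.toSyn (e j) := by
        rw [hf k]
        exact lt_of_le_of_ne (hmax k ⟨hk, hgk⟩) fun h => hkj (he (m.toSyn.injective h))
      rw [coeff_smul, m.coeff_eq_zero_of_lt hlt, smul_zero]

/-- Elements with distinct leading exponents are independent, which gives `≤`. Conversely, reading
off the coefficients at the leading exponents is injective on `U`, since a nonzero element has a
nonzero coefficient at its own. -/
theorem ncard_leadExps {s : ℕ} {K : Type*} [Field K] (m : MonomialOrder (Fin s)) {e : ℕ}
    {U : Submodule K (MvPolynomial (Fin s) K)} (hU : U ≤ homogeneousSubmodule (Fin s) K e) :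
    (leadExps m U).ncard = Module.finrank K U := by
  have hfin := leadExps_finite m hU
  have := hfin.fintype
  have : Module.Finite K U := Submodule.finiteDimensional_of_le hU
  rw [← Nat.card_coe_set_eq, Nat.card_eq_fintype_card]
  apply le_antisymm
  · choose f hfU hf0 hf using fun a : leadExps m U => a.2
    have hli := linearIndependent_of_degree_eq m (fun a : leadExps m U => (a : Fin s →₀ ℕ))
      Subtype.val_injective f hf0 hf
    have hli' : LinearIndependent K (fun a => (⟨f a, hfU a⟩ : U)) :=
      LinearIndependent.of_comp U.subtype hli
    exact hli'.fintype_card_le_finrank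
  · let φ : U →ₗ[K] (leadExps m U → K) :=
      LinearMap.pi (fun a => lcoeff K (a : Fin s →₀ ℕ)) ∘ₗ U.subtype
    have hφ : Function.Injective φ := by
      rw [injective_iff_map_eq_zero]
      intro f hf
      by_contra h0
      have h0' : (f : MvPolynomial (Fin s) K) ≠ 0 := fun h => h0 (Subtype.ext h)
      have := congrFun hf ⟨m.degree f.1, f.1, f.2, h0', rfl⟩
      exact m.coeff_degree_ne_zero_iff.2 h0' this
    simpa using LinearMap.finrank_le_finrank_of_injective hφ

/-- The homogeneous elements of degree `e` of an ideal. -/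
def gradedPiece {s : ℕ} {K : Type*} [Field K] (J : Ideal (MvPolynomial (Fin s) K)) (e : ℕ) :
    Submodule K (MvPolynomial (Fin s) K) :=
  homogeneousSubmodule (Fin s) K e ⊓ J.restrictScalars K

theorem hilbertFn_add_finrank_gradedPiece {s : ℕ} {K : Type*} [Field K]
    (J : Ideal (MvPolynomial (Fin s) K)) (e : ℕ) :
    hilbertFn J e + Module.finrank K (gradedPiece J e) =
      Module.finrank K (homogeneousSubmodule (Fin s) K e) := by
  rw [gradedPiece, ← Submodule.map_comap_subtype, Submodule.finrank_map_subtype_eq]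
  exact Submodule.finrank_quotient_add_finrank _

theorem monomial_mem_span_iff {s : ℕ} {K : Type*} [Field K] {A : Set (Fin s →₀ ℕ)}
    {a : Fin s →₀ ℕ} :
    monomial a (1 : K) ∈ Ideal.span ((fun b => monomial b (1 : K)) '' A) ↔ ∃ b ∈ A, b ≤ a := by
  rw [mem_ideal_span_monomial_image]
  simp

theorem initialIdeal_eq_span {s : ℕ} {K : Type*} [Field K] (m : MonomialOrder (Fin s))
    (J : Ideal (MvPolynomial (Fin s) K)) :
    initialIdeal m J =
      Ideal.span ((fun b => monomial b (1 : K)) '' leadExps m (J.restrictScalars K)) := by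
  rw [initialIdeal]
  congr 1
  ext g
  constructor
  · rintro ⟨f, hf, h0, rfl⟩
    exact ⟨_, ⟨f, hf, h0, rfl⟩, rfl⟩
  · rintro ⟨_, ⟨f, hf, h0, rfl⟩, rfl⟩
    exact ⟨f, hf, h0, rfl⟩

theorem monomial_mem_initialIdeal_iff {s : ℕ} {K : Type*} [Field K] (m : MonomialOrder (Fin s))
    {J : Ideal (MvPolynomial (Fin s) K)} {a : Fin s →₀ ℕ} :
    monomial a (1 : K) ∈ initialIdeal m J ↔ ∃ f ∈ J, f ≠ 0 ∧ m.degree f ≤ a := by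
  rw [initialIdeal_eq_span, monomial_mem_span_iff]
  constructor
  · rintro ⟨_, ⟨f, hf, h0, rfl⟩, h⟩
    exact ⟨f, hf, h0, h⟩
  · rintro ⟨f, hf, h0, h⟩
    exact ⟨_, ⟨f, hf, h0, rfl⟩, h⟩

theorem initialIdeal_mono {s : ℕ} {K : Type*} [Field K] (m : MonomialOrder (Fin s))
    {I J : Ideal (MvPolynomial (Fin s) K)} (h : I ≤ J) : initialIdeal m I ≤ initialIdeal m J :=
  Ideal.span_mono fun _ ⟨f, hf, h0, hg⟩ => ⟨f, h hf, h0, hg⟩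

/-- The exponents of the monomials outside an ideal. -/
def standardExps {s : ℕ} {K : Type*} [Field K] (J : Ideal (MvPolynomial (Fin s) K)) :
    Set (Fin s →₀ ℕ) :=
  {a | monomial a (1 : K) ∉ J}

theorem isLowerSet_standardExps {s : ℕ} {K : Type*} [Field K]
    (J : Ideal (MvPolynomial (Fin s) K)) : IsLowerSet (standardExps J) := by
  intro a b hba ha hb
  refine ha ?_
  have := J.mul_mem_left (monomial (a - b) (1 : K)) hb
  rwa [monomial_mul, one_mul, tsub_add_cancel_of_le hba] at this

theorem leadExps_gradedPiece {s : ℕ} {K : Type*} [Field K] (m : MonomialOrder (Fin s))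
    {J : Ideal (MvPolynomial (Fin s) K)}
    (hJ : ∀ f ∈ J, ∀ n, homogeneousComponent n f ∈ J) (e : ℕ) :
    leadExps m (gradedPiece J e) = {a | a.degree = e ∧ monomial a (1 : K) ∈ initialIdeal m J} := by
  ext a
  constructor
  · rintro ⟨f, hf, h0, rfl⟩
    exact ⟨degree_leadingExp m hf.1 h0, monomial_mem_initialIdeal_iff m |>.2
      ⟨f, hf.2, h0, le_rfl⟩⟩
  · rintro ⟨rfl, h⟩
    obtain ⟨f, hf, h0, hle⟩ := (monomial_mem_initialIdeal_iff m).1 h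
    have hm0 : monomial (a - m.degree f) (1 : K) ≠ 0 := by simp
    set g := monomial (a - m.degree f) (1 : K) * f with hg
    have hgJ : g ∈ J := J.mul_mem_left _ hf
    have hdeg : m.degree g = a := by
      classical
      rw [hg, m.degree_mul hm0 h0, m.degree_monomial, if_neg one_ne_zero,
        tsub_add_cancel_of_le hle]
    have hg0 : g ≠ 0 := mul_ne_zero hm0 h0
    have hca : coeff a (homogeneousComponent a.degree g) ≠ 0 := by
      rw [coeff_homogeneousComponent, if_pos rfl]
      nth_rewrite 1 [← hdeg]
      exact m.coeff_degree_ne_zero_iff.2 hg0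
    -- The order need not be compatible with degree, so `g` may have terms of other degrees; its
    -- component of degree `|a|` keeps the leading term and stays in `J`.
    refine ⟨homogeneousComponent a.degree g,
      ⟨homogeneousComponent_isHomogeneous _ _, hJ g hgJ _⟩, fun h => hca (by simp [h]), ?_⟩
    apply m.toSyn.injective
    apply le_antisymm
    · rw [m.degree_le_iff]
      intro b hb
      have hbg : b ∈ g.support := by
        rw [mem_support_iff, coeff_homogeneousComponent] at hb
        exact mem_support_iff.2 fun h => hb (by simp [h])
      simpa [hdeg] using m.le_degree hbg
    · exact m.le_degree (mem_support_iff.2 hca)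

theorem leadExps_homogeneousSubmodule {s : ℕ} {K : Type*} [Field K] (m : MonomialOrder (Fin s))
    (e : ℕ) : leadExps m (homogeneousSubmodule (Fin s) K e) = {a | a.degree = e} := by
  ext a
  constructor
  · rintro ⟨f, hf, h0, rfl⟩
    exact degree_leadingExp m hf h0
  · intro ha
    classical
    exact ⟨monomial a 1, isHomogeneous_monomial _ ha, by simp, by simp [m.degree_monomial]⟩

/-- Macaulay's theorem: the standard monomials of degree `e` form a basis of `S_e / J_e`. -/
theorem hilbertFn_eq_ncard_footprint {s : ℕ} {K : Type*} [Field K] (m : MonomialOrder (Fin s))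
    {J : Ideal (MvPolynomial (Fin s) K)}
    (hJ : ∀ f ∈ J, ∀ n, homogeneousComponent n f ∈ J) (e : ℕ) :
    hilbertFn J e = (slice (standardExps (initialIdeal m J)) e).ncard := by
  have h1 := hilbertFn_add_finrank_gradedPiece J e
  rw [← ncard_leadExps m le_rfl, 
    ← ncard_leadExps m (U := gradedPiece J e) inf_le_left] at h1
  have hsub : leadExps m (gradedPiece J e) ⊆ leadExps m (homogeneousSubmodule (Fin s) K e) :=
    fun a ⟨f, hf, h⟩ => ⟨f, hf.1, h⟩
  have h2 := Set.ncard_sdiff_add_ncard_of_subset hsub (leadExps_finite m le_rfl)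
  have h3 : leadExps m (homogeneousSubmodule (Fin s) K e) \ leadExps m (gradedPiece J e) =
      slice (standardExps (initialIdeal m J)) e := by
    rw [leadExps_gradedPiece m hJ, leadExps_homogeneousSubmodule]
    ext a
    simp only [slice, standardExps, Set.mem_sdiff, Set.mem_ofPred_eq]
    tauto
  rw [h3] at h2
  omega

theorem homogeneousComponent_mem_span_monomial {s : ℕ} {K : Type*} [Field K]
    {A : Set (Fin s →₀ ℕ)} {f : MvPolynomial (Fin s) K}
    (hf : f ∈ Ideal.span ((fun b => monomial b (1 : K)) '' A)) (n : ℕ) :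
    homogeneousComponent n f ∈ Ideal.span ((fun b => monomial b (1 : K)) '' A) := by
  rw [mem_ideal_span_monomial_image] at hf ⊢
  intro b hb
  refine hf b ?_
  rw [mem_support_iff, coeff_homogeneousComponent] at hb
  exact mem_support_iff.2 fun h => hb (by simp [h])

/-- A monomial ideal contains every monomial of its elements, leading ones included. This lets
Macaulay's theorem compute the Hilbert function of `(in(I), M)` directly. -/
theorem standardExps_initialIdeal_span_monomial {s : ℕ} {K : Type*} [Field K]
    (m : MonomialOrder (Fin s)) (A : Set (Fin s →₀ ℕ)) :
    standardExps (initialIdeal m (Ideal.span ((fun b => monomial b (1 : K)) '' A))) =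
      standardExps (Ideal.span ((fun b => monomial b (1 : K)) '' A)) := by
  classical
  ext a
  simp only [standardExps, Set.mem_ofPred_eq, not_iff_not, monomial_mem_initialIdeal_iff,
    monomial_mem_span_iff]
  constructor
  · rintro ⟨f, hf, h0, hle⟩
    obtain ⟨b, hb, hba⟩ := mem_ideal_span_monomial_image.1 hf _ (m.degree_mem_support h0)
    exact ⟨b, hb, hba.trans hle⟩
  · rintro ⟨b, hb, hba⟩
    exact ⟨monomial b 1, Ideal.subset_span ⟨b, hb, rfl⟩, by simp, by simpa [m.degree_monomial]⟩

theorem hilbertFn_span_monomial {s : ℕ} {K : Type*} [Field K] (m : MonomialOrder (Fin s))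
    (A : Set (Fin s →₀ ℕ)) (e : ℕ) :
    hilbertFn (Ideal.span ((fun b => monomial b (1 : K)) '' A)) e =
      (slice (standardExps (Ideal.span ((fun b => monomial b (1 : K)) '' A))) e).ncard := by
  rw [hilbertFn_eq_ncard_footprint m (fun f hf n => homogeneousComponent_mem_span_monomial hf n),
    standardExps_initialIdeal_span_monomial]

/-! ### Vanishing ideals of finite sets of projective points -/

theorem eval_smul_of_isHomogeneous {s : ℕ} {K : Type*} [Field K] {f : MvPolynomial (Fin s) K}
    {n : ℕ} (hf : f.IsHomogeneous n) (c : K) (α : Fin s → K) :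
    eval (c • α) f = c ^ n * eval α f := by
  rw [eval_eq', eval_eq', Finset.mul_sum]
  refine Finset.sum_congr rfl fun b hb => ?_
  have hn : b.degree = n := by
    by_contra h
    exact mem_support_iff.1 hb (hf.coeff_eq_zero h)
  rw [← hn, Finsupp.degree_eq_sum]
  simp only [Pi.smul_apply, smul_eq_mul, mul_pow, Finset.prod_mul_distrib,
    Finset.prod_pow_eq_pow_sum]
  ring

theorem eval_eq_zero_of_mk_eq {s : ℕ} {K : Type*} [Field K] {f : MvPolynomial (Fin s) K}
    {n : ℕ} (hf : f.IsHomogeneous n) {α β : Fin s → K} (hα : α ≠ 0) (hβ : β ≠ 0)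
    (h : Projectivization.mk K α hα = Projectivization.mk K β hβ) (h0 : eval β f = 0) :
    eval α f = 0 := by
  obtain ⟨c, rfl⟩ := (Projectivization.mk_eq_mk_iff' K _ _ hα hβ).1 h
  rw [eval_smul_of_isHomogeneous hf, h0, mul_zero]

theorem eval_eq_zero_of_mem_vanishingIdeal {s : ℕ} {K : Type*} [Field K]
    {X : Set (ℙ K (Fin s → K))} {f : MvPolynomial (Fin s) K} (hf : f ∈ vanishingIdeal X)
    {α : Fin s → K} (hα : α ≠ 0) (hX : Projectivization.mk K α hα ∈ X) : eval α f = 0 := by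
  have : vanishingIdeal X ≤ RingHom.ker (eval α) :=
    Ideal.span_le.2 fun g hg => hg.2 α hα hX
  exact this hf

theorem vanishingIdeal_anti {s : ℕ} {K : Type*} [Field K]
    {X Y : Set (ℙ K (Fin s → K))} (h : X ⊆ Y) : vanishingIdeal Y ≤ vanishingIdeal X :=
  Ideal.span_mono fun _ hf => ⟨hf.1, fun α hα hX => hf.2 α hα (h hX)⟩

section

attribute [local instance] MvPolynomial.gradedAlgebra

theorem homogeneousComponent_mem_vanishingIdeal {s : ℕ} {K : Type*} [Field K]
    (X : Set (ℙ K (Fin s → K))) {f : MvPolynomial (Fin s) K} (hf : f ∈ vanishingIdeal X)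
    (n : ℕ) : homogeneousComponent n f ∈ vanishingIdeal X :=
  homogeneousComponent_mem_of_mem
    (Ideal.homogeneous_span _ _ fun _ hg => ⟨hg.1.choose, hg.1.choose_spec⟩) hf n

end

/-- For a form, vanishing does not depend on the representative, so the chosen ones suffice. -/
theorem mem_vanishingIdeal_range_iff {s : ℕ} {K : Type*} [Field K] {ι : Type*}
    (v : ι → Fin s → K) (hv0 : ∀ i, v i ≠ 0) {f : MvPolynomial (Fin s) K} {n : ℕ}
    (hf : f.IsHomogeneous n) :
    f ∈ vanishingIdeal (Set.range fun i => Projectivization.mk K (v i) (hv0 i)) ↔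
      ∀ i, eval (v i) f = 0 := by
  constructor
  · exact fun h i => eval_eq_zero_of_mem_vanishingIdeal h (hv0 i) ⟨i, rfl⟩
  · intro h
    refine Ideal.subset_span ⟨⟨n, hf⟩, ?_⟩
    rintro α hα ⟨i, hi⟩
    exact eval_eq_zero_of_mk_eq hf hα (hv0 i) hi.symm (h i)

theorem ker_evalMap {s : ℕ} {K : Type*} [Field K] {ι : Type*}
    (v : ι → Fin s → K) (hv0 : ∀ i, v i ≠ 0) (e : ℕ) :
    LinearMap.ker (evalMap v e) =
      ((vanishingIdeal (Set.range fun i =>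
        Projectivization.mk K (v i) (hv0 i))).restrictScalars K).comap
          (homogeneousSubmodule (Fin s) K e).subtype := by
  ext ⟨f, hf⟩
  have := mem_vanishingIdeal_range_iff v hv0 hf
  simp only [LinearMap.mem_ker, Submodule.mem_comap, Submodule.subtype_apply,
    Submodule.restrictScalars_mem, this]
  exact funext_iff

theorem hilbertFn_vanishingIdeal_eq_finrank {s : ℕ} {K : Type*} [Field K] {ι : Type*}
    (v : ι → Fin s → K) (hv0 : ∀ i, v i ≠ 0) (e : ℕ) :
    hilbertFn (vanishingIdeal (Set.range fun i => Projectivization.mk K (v i) (hv0 i))) e =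
      Module.finrank K (reedMullerCode v e) := by
  rw [hilbertFn, ← ker_evalMap, reedMullerCode]
  exact (evalMap v e).quotKerEquivRange.finrank_eq

/-- The forms `β_i X_k - β_k X_i` vanish at `β`; if all of them vanished at `α`, the two vectors
would be proportional. -/
theorem exists_linear_separating {s : ℕ} {K : Type*} [Field K] {α β : Fin s → K} (hα : α ≠ 0)
    (hβ : β ≠ 0) (h : Projectivization.mk K α hα ≠ Projectivization.mk K β hβ) :
    ∃ l : MvPolynomial (Fin s) K, l.IsHomogeneous 1 ∧ eval α l ≠ 0 ∧ eval β l = 0 := by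
  obtain ⟨i, hi⟩ := Function.ne_iff.1 hβ
  by_contra! hc
  refine h ((Projectivization.mk_eq_mk_iff' K _ _ hα hβ).2 ⟨α i / β i, ?_⟩)
  ext k
  by_contra hk
  refine hc (C (β i) * X k - C (β k) * X i)
    ((isHomogeneous_C_mul_X _ _).sub (isHomogeneous_C_mul_X _ _)) ?_ (by simp; ring)
  simp only [map_sub, map_mul, eval_C, eval_X]
  intro h0
  refine hk ?_
  have hi' : β i ≠ 0 := hi
  simp only [Pi.smul_apply, smul_eq_mul]
  field_simp
  linear_combination -h0

/-- Multiply the linear forms separating `v i` from the other points, and pad to degree `e` with a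
power of a variable that is nonzero at `v i`. -/
theorem exists_separating {s : ℕ} {K : Type*} [Field K] {ι : Type*} [Fintype ι]
    (v : ι → Fin s → K) (hv0 : ∀ i, v i ≠ 0)
    (hinj : Function.Injective fun i => Projectivization.mk K (v i) (hv0 i)) {e : ℕ}
    (he : Fintype.card ι ≤ e) (i : ι) :
    ∃ f : MvPolynomial (Fin s) K, f.IsHomogeneous e ∧ eval (v i) f ≠ 0 ∧
      ∀ j, j ≠ i → eval (v j) f = 0 := by
  classical
  have hl : ∀ j, ∃ l : MvPolynomial (Fin s) K, j ≠ i →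
      l.IsHomogeneous 1 ∧ eval (v i) l ≠ 0 ∧ eval (v j) l = 0 := by
    intro j
    by_cases hji : j = i
    · exact ⟨0, fun h => absurd hji h⟩
    · obtain ⟨l, h⟩ := exists_linear_separating (hv0 i) (hv0 j) fun h => hji (hinj h).symm
      exact ⟨l, fun _ => h⟩
  choose l hl using hl
  obtain ⟨k, hk⟩ := Function.ne_iff.1 (hv0 i)
  refine ⟨(∏ j ∈ Finset.univ.erase i, l j) * X k ^ (e - (Finset.univ.erase i).card), ?_, ?_, ?_⟩
  · have h1 := (IsHomogeneous.prod (Finset.univ.erase i) l (fun _ => 1) fun j hj =>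
      (hl j (Finset.ne_of_mem_erase hj)).1).mul
        (isHomogeneous_X_pow (R := K) k (e - (Finset.univ.erase i).card))
    have h2 : (Finset.univ.erase i).card ≤ e :=
      (Finset.card_erase_le).trans (by simpa using he)
    rwa [Finset.sum_const, smul_eq_mul, mul_one, Nat.add_sub_cancel' h2] at h1
  · rw [map_mul, map_pow, eval_X, map_prod]
    exact mul_ne_zero (Finset.prod_ne_zero_iff.2 fun j hj =>
      (hl j (Finset.ne_of_mem_erase hj)).2.1) (pow_ne_zero _ hk)
  · intro j hj
    rw [map_mul, map_prod, Finset.prod_eq_zero (i := j) (by simp [hj]) (hl j hj).2.2, zero_mul]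

theorem reedMullerCode_eq_top {s : ℕ} {K : Type*} [Field K] {ι : Type*} [Fintype ι]
    (v : ι → Fin s → K) (hv0 : ∀ i, v i ≠ 0)
    (hinj : Function.Injective fun i => Projectivization.mk K (v i) (hv0 i)) {e : ℕ}
    (he : Fintype.card ι ≤ e) : reedMullerCode v e = ⊤ := by
  classical
  rw [eq_top_iff, ← (Pi.basisFun K ι).span_eq, Submodule.span_le]
  rintro _ ⟨i, rfl⟩
  obtain ⟨f, hf, hi, hj⟩ := exists_separating v hv0 hinj he i
  refine ⟨(eval (v i) f)⁻¹ • ⟨f, hf⟩, ?_⟩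
  ext j
  rw [map_smul, Pi.smul_apply]
  change (eval (v i) f)⁻¹ * eval (v j) f = _
  rw [Pi.basisFun_apply]
  by_cases hji : j = i
  · subst hji
    simpa using inv_mul_cancel₀ hi
  · simpa [hji] using Or.inr (hj j hji)

theorem hilbertFn_vanishingIdeal {s : ℕ} {K : Type*} [Field K] {ι : Type*} [Fintype ι]
    (v : ι → Fin s → K) (hv0 : ∀ i, v i ≠ 0)
    (hinj : Function.Injective fun i => Projectivization.mk K (v i) (hv0 i)) {e : ℕ}
    (he : Fintype.card ι ≤ e) :
    hilbertFn (vanishingIdeal (Set.range fun i => Projectivization.mk K (v i) (hv0 i))) e =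
      Fintype.card ι := by
  rw [hilbertFn_vanishingIdeal_eq_finrank, reedMullerCode_eq_top v hv0 hinj he]
  simp

theorem hilbertFn_vanishingIdeal_le {s : ℕ} {K : Type*} [Field K] {ι : Type*} [Fintype ι]
    (v : ι → Fin s → K) (hv0 : ∀ i, v i ≠ 0) (e : ℕ) :
    hilbertFn (vanishingIdeal (Set.range fun i => Projectivization.mk K (v i) (hv0 i))) e ≤
      Fintype.card ι := by
  rw [hilbertFn_vanishingIdeal_eq_finrank]
  simpa using (reedMullerCode v e).finrank_le

/-! ### Krull dimension and degree -/

/-- The hypothesis makes `S/P` a quotient of `K[x]`, with `x` mapping to the class of `g`, for every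
prime `P` over `J`. It is thus a principal ideal domain, so any prime strictly above `P` is maximal.
-/
theorem krullDim_le_one {s : ℕ} {K : Type*} [Field K] {J : Ideal (MvPolynomial (Fin s) K)}
    (h : ∀ P : Ideal (MvPolynomial (Fin s) K), P.IsPrime → J ≤ P →
      ∃ (g : MvPolynomial (Fin s) K) (c : Fin s → K), ∀ k, X k - C (c k) * g ∈ P) :
    Ring.KrullDimLE 1 (MvPolynomial (Fin s) K ⧸ J) := by
  refine Ring.krullDimLE_one_iff.2 fun Q hQ => or_iff_not_imp_left.2 fun hQ' => ?_
  rw [minimalPrimes_eq_minimals, Set.notMem_ofPred_iff, not_minimal_iff_exists_lt hQ] at hQ'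
  obtain ⟨P, hlt, hP⟩ := hQ'
  obtain ⟨g, c, hg⟩ := h (P.comap (Ideal.Quotient.mk J)) (Ideal.comap_isPrime _ _) (by
    intro f hf
    rw [Ideal.mem_comap, Ideal.Quotient.eq_zero_iff_mem.2 hf]
    exact zero_mem _)
  let π : MvPolynomial (Fin s) K →ₐ[K] ((MvPolynomial (Fin s) K ⧸ J) ⧸ P) :=
    (Ideal.Quotient.mkₐ K P).comp (Ideal.Quotient.mkₐ K J)
  have hπ : Function.Surjective π :=
    (Ideal.Quotient.mkₐ_surjective K P).comp (Ideal.Quotient.mkₐ_surjective K J)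
  have hX : ∀ k, π (X k) = c k • π g := by
    intro k
    have : π (X k - C (c k) * g) = 0 := Ideal.Quotient.eq_zero_iff_mem.2 (hg k)
    rw [map_sub, sub_eq_zero] at this
    rw [this, ← smul_eq_C_mul, map_smul]
  let ψ : Polynomial K →ₐ[K] ((MvPolynomial (Fin s) K ⧸ J) ⧸ P) := Polynomial.aeval (π g)
  have hψ : Function.Surjective ψ := by
    have h1 : π = ψ.comp (aeval fun k => c k • (Polynomial.X : Polynomial K)) := by
      ext k
      simp [ψ, hX]
    intro y
    obtain ⟨f, rfl⟩ := hπ y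
    exact ⟨_, (DFunLike.congr_fun h1 f).symm⟩
  have hP' : P.IsPrime := hP
  have := IsPrincipalIdealRing.of_surjective ψ.toRingHom hψ
  have : (Q.map (Ideal.Quotient.mk P)).IsMaximal := by
    have := Ideal.map_isPrime_of_surjective (f := Ideal.Quotient.mk P) Ideal.Quotient.mk_surjective
      (I := Q) (by simpa using hlt.le)
    refine IsPrime.to_maximal_ideal (S := Q.map (Ideal.Quotient.mk P)) ?_
    rw [ne_eq, Ideal.map_eq_bot_iff_le_ker, Ideal.mk_ker]
    exact hlt.not_ge
  have := Ideal.comap_isMaximal_of_surjective (Ideal.Quotient.mk P) Ideal.Quotient.mk_surjective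
    (K := Q.map (Ideal.Quotient.mk P))
  simpa [Ideal.comap_map_of_surjective' (Ideal.Quotient.mk P) Ideal.Quotient.mk_surjective,
    hlt.le] using this

/-- By `hJ` the ideal vanishes on the line through `c`, so `S/J` maps onto `K[x]`. -/
theorem krullDim_eq_one {s : ℕ} {K : Type*} [Field K] {J : Ideal (MvPolynomial (Fin s) K)}
    (h : Ring.KrullDimLE 1 (MvPolynomial (Fin s) K ⧸ J)) {c : Fin s → K} (hc : c ≠ 0)
    (hJ : ∀ f ∈ J, aeval (fun k => Polynomial.C (c k) * Polynomial.X) f = (0 : Polynomial K)) :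
    krullDim J = 1 := by
  let φ : MvPolynomial (Fin s) K →ₐ[K] Polynomial K :=
    aeval fun k => Polynomial.C (c k) * Polynomial.X
  obtain ⟨k, hk⟩ := Function.ne_iff.1 hc
  have hφ : Function.Surjective (Ideal.Quotient.lift J φ.toRingHom hJ) := by
    refine Ideal.Quotient.lift_surjective_of_surjective _ _ fun p => ?_
    have : φ.comp (Polynomial.aeval (C (c k)⁻¹ * X k)) = AlgHom.id K (Polynomial K) := by
      ext
      have hk' : c k ≠ 0 := hk
      simp [φ, ← mul_assoc, ← Polynomial.C_mul, inv_mul_cancel₀ hk', -algebraMap_eq,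
        Polynomial.algebraMap_eq]
    exact ⟨_, DFunLike.congr_fun this p⟩
  have h1 := ringKrullDim_le_of_surjective _ hφ
  rw [Polynomial.ringKrullDim_of_isNoetherianRing, ringKrullDim_eq_zero_of_field, zero_add] at h1
  rw [Ring.krullDimLE_iff] at h
  rw [krullDim, le_antisymm h h1]
  rfl

theorem deg_eq_of_eventually {s : ℕ} {K : Type*} [Field K] {J : Ideal (MvPolynomial (Fin s) K)}
    (h : krullDim J = 1) {c : ℕ} (hc : ∀ᶠ e in Filter.atTop, hilbertFn J e = c) :
    deg J = c := by
  rw [deg, if_pos h.ge, h]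
  simp only [Nat.sub_self, Nat.factorial_zero, Nat.cast_one, one_mul, pow_zero, div_one]
  refine Filter.Tendsto.limUnder_eq (tendsto_const_nhds.congr' ?_)
  filter_upwards [hc] with e he
  rw [he]

theorem krullDimLE_one_vanishingIdeal {s : ℕ} {K : Type*} [Field K] {ι : Type*} [Fintype ι]
    (v : ι → Fin s → K) (hv0 : ∀ i, v i ≠ 0) :
    Ring.KrullDimLE 1 (MvPolynomial (Fin s) K ⧸
      vanishingIdeal (Set.range fun i => Projectivization.mk K (v i) (hv0 i))) := by
  refine krullDim_le_one fun P hP hle => ?_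
  by_contra! hc
  choose j hj using fun i => Function.ne_iff.1 (hv0 i)
  -- Were the conclusion false, each point would give a linear form through it that is not in `P`;
  -- the product vanishes at all points, hence lies in `P`, a contradiction.
  choose k hk using fun i => hc (X (j i)) fun k => v i k / v i (j i)
  have hmem : ∏ i, (X (k i) - C (v i (k i) / v i (j i)) * X (j i)) ∈
      vanishingIdeal (Set.range fun i => Projectivization.mk K (v i) (hv0 i)) := by
    rw [mem_vanishingIdeal_range_iff v hv0 (IsHomogeneous.prod Finset.univ _ (fun _ => 1)
      fun i _ => (isHomogeneous_X _ _).sub (isHomogeneous_C_mul_X _ _))]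
    intro i
    have hji : v i (j i) ≠ 0 := hj i
    rw [map_prod]
    refine Finset.prod_eq_zero (Finset.mem_univ i) ?_
    simp [div_mul_cancel₀ _ hji]
  obtain ⟨i, -, hi⟩ := hP.prod_mem_iff.1 (hle hmem)
  exact hk i hi

theorem aeval_C_mul_X_of_isHomogeneous {s : ℕ} {K : Type*} [Field K]
    {f : MvPolynomial (Fin s) K} {n : ℕ} (hf : f.IsHomogeneous n) (c : Fin s → K) :
    aeval (fun k => Polynomial.C (c k) * Polynomial.X) f =
      Polynomial.C (eval c f) * (Polynomial.X : Polynomial K) ^ n := by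
  rw [aeval_def, eval₂_eq', eval_eq', map_sum, Finset.sum_mul]
  refine Finset.sum_congr rfl fun b hb => ?_
  have hn : b.degree = n := by
    by_contra h
    exact mem_support_iff.1 hb (hf.coeff_eq_zero h)
  rw [← hn, Finsupp.degree_eq_sum]
  simp only [mul_pow, Finset.prod_mul_distrib, Finset.prod_pow_eq_pow_sum, map_mul, map_prod,
    map_pow, Polynomial.algebraMap_eq]
  ring

theorem krullDim_vanishingIdeal {s : ℕ} {K : Type*} [Field K] {ι : Type*} [Fintype ι] [Nonempty ι]
    (v : ι → Fin s → K) (hv0 : ∀ i, v i ≠ 0) :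
    krullDim (vanishingIdeal (Set.range fun i => Projectivization.mk K (v i) (hv0 i))) = 1 := by
  obtain ⟨i⟩ := ‹Nonempty ι›
  refine krullDim_eq_one (krullDimLE_one_vanishingIdeal v hv0) (hv0 i) fun f hf => ?_
  let φ : MvPolynomial (Fin s) K →ₐ[K] Polynomial K :=
    aeval fun k => Polynomial.C (v i k) * Polynomial.X
  have : vanishingIdeal (Set.range fun i => Projectivization.mk K (v i) (hv0 i)) ≤
      RingHom.ker φ := by
    refine Ideal.span_le.2 ?_
    rintro g ⟨⟨n, hg⟩, h⟩
    refine (aeval_C_mul_X_of_isHomogeneous hg _).trans ?_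
    rw [h _ (hv0 i) ⟨i, rfl⟩, map_zero, zero_mul]
  exact this hf

theorem deg_vanishingIdeal {s : ℕ} {K : Type*} [Field K] {ι : Type*} [Fintype ι] [Nonempty ι]
    (v : ι → Fin s → K) (hv0 : ∀ i, v i ≠ 0)
    (hinj : Function.Injective fun i => Projectivization.mk K (v i) (hv0 i)) :
    deg (vanishingIdeal (Set.range fun i => Projectivization.mk K (v i) (hv0 i))) =
      Fintype.card ι :=
  deg_eq_of_eventually (krullDim_vanishingIdeal v hv0) (Filter.eventually_atTop.2
    ⟨_, fun _ he => hilbertFn_vanishingIdeal v hv0 hinj he⟩)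

/-- For `i ≠ j` the monomial `t_i^n t_j^n` lies in `J`, so a prime over `J` contains all variables
but at most one. -/
theorem krullDimLE_one_of_ncard_slice_le {s n : ℕ} {K : Type*} [Field K]
    {J : Ideal (MvPolynomial (Fin s) K)} (hn : ∀ e, (slice (standardExps J) e).ncard ≤ n) :
    Ring.KrullDimLE 1 (MvPolynomial (Fin s) K ⧸ J) := by
  classical
  refine krullDim_le_one fun P hP hle => ?_
  have hpair : ∀ i j : Fin s, i ≠ j → X i ∈ P ∨ X j ∈ P := by
    intro i j hij
    have hmem : monomial (Finsupp.single i n + Finsupp.single j n) (1 : K) ∈ J := by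
      by_contra h
      have := coord_lt_of_ncard_slice_le (isLowerSet_standardExps J) hn h hij (by simp)
      simp at this
    have h2 := hle hmem
    rw [← one_mul (1 : K), ← monomial_mul, ← X_pow_eq_monomial, ← X_pow_eq_monomial] at h2
    exact (hP.mem_or_mem h2).imp (hP.mem_of_pow_mem n) (hP.mem_of_pow_mem n)
  by_cases h : ∀ k : Fin s, X k ∈ P
  · exact ⟨0, 0, fun k => by simpa using h k⟩
  · push Not at h
    obtain ⟨i, hi⟩ := h
    refine ⟨X i, Pi.single i 1, fun k => ?_⟩
    by_cases hki : k = i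
    · simp [hki]
    · simpa [hki] using (hpair k i hki).resolve_right hi

/-- No generator is a power of `t_i`, so each involves another variable and vanishes on the `i`-th
axis. -/
theorem krullDim_span_monomial {s n : ℕ} {K : Type*} [Field K] {A : Set (Fin s →₀ ℕ)}
    (hn : ∀ e, (slice (standardExps
      (Ideal.span ((fun b => monomial b (1 : K)) '' A))) e).ncard ≤ n) {i : Fin s}
    (hi : ∀ k, Finsupp.single i k ∈ standardExps (Ideal.span ((fun b => monomial b (1 : K)) '' A))) :
    krullDim (Ideal.span ((fun b => monomial b (1 : K)) '' A)) = 1 := by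
  classical
  refine krullDim_eq_one (krullDimLE_one_of_ncard_slice_le hn) (c := Pi.single i 1) (by simp)
    fun f hf => ?_
  let φ : MvPolynomial (Fin s) K →ₐ[K] Polynomial K :=
    aeval fun k => Polynomial.C ((Pi.single i 1 : Fin s → K) k) * Polynomial.X
  have : Ideal.span ((fun b => monomial b (1 : K)) '' A) ≤ RingHom.ker φ := by
    refine Ideal.span_le.2 ?_
    rintro _ ⟨b, hb, rfl⟩
    have hex : ∃ k, k ≠ i ∧ b k ≠ 0 := by
      by_contra! h
      refine hi (b i) (monomial_mem_span_iff.2 ⟨b, hb, fun k => ?_⟩)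
      by_cases hki : k = i
      · simp [hki]
      · simp [h k hki]
    obtain ⟨k, hki, hk⟩ := hex
    change φ (monomial b 1) = 0
    rw [aeval_monomial, Finsupp.prod_fintype _ _ (by simp),
      Finset.prod_eq_zero (Finset.mem_univ k) (by simp [hki, hk]), mul_zero]
  exact this hf

/-- The sign of a `limUnder` is known only once the limit exists; here the Hilbert function is
eventually constant. This serves the case of a subcode with full support. -/
theorem deg_span_monomial_nonneg {s n : ℕ} {K : Type*} [Field K] (m : MonomialOrder (Fin s))
    {A : Set (Fin s →₀ ℕ)}
    (hn : ∀ e, (slice (standardExps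
      (Ideal.span ((fun b => monomial b (1 : K)) '' A))) e).ncard ≤ n) :
    0 ≤ deg (Ideal.span ((fun b => monomial b (1 : K)) '' A)) := by
  by_cases h1 : 1 ≤ krullDim (Ideal.span ((fun b => monomial b (1 : K)) '' A))
  · have hle : krullDim (Ideal.span ((fun b => monomial b (1 : K)) '' A)) ≤ 1 := by
      have h2 := Ring.krullDimLE_iff.1 (krullDimLE_one_of_ncard_slice_le hn)
      rw [krullDim]
      generalize ringKrullDim (MvPolynomial (Fin s) K ⧸
        Ideal.span ((fun b => monomial b (1 : K)) '' A)) = x at h2 ⊢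
      induction x using WithBot.recBotCoe with
      | bot => simp
      | coe y => exact ENat.toNat_le_of_le_natCast (by simpa using h2)
    obtain ⟨c, hc⟩ := eventually_ncard_slice_eq (isLowerSet_standardExps _) hn
    rw [deg_eq_of_eventually (le_antisymm hle h1) (c := c)]
    · positivity
    · simpa only [hilbertFn_span_monomial m] using hc
  · rw [deg, if_neg h1]
    positivity

theorem le_deg_span_monomial {s n : ℕ} {K : Type*} [Field K] (m : MonomialOrder (Fin s))
    {A : Set (Fin s →₀ ℕ)}
    (hn : ∀ e, (slice (standardExps
      (Ideal.span ((fun b => monomial b (1 : K)) '' A))) e).ncard ≤ n) {i : Fin s}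
    (hi : ∀ k, Finsupp.single i k ∈ standardExps (Ideal.span ((fun b => monomial b (1 : K)) '' A)))
    {l : ℕ} (hl : ∀ᶠ e in Filter.atTop, l ≤ (slice (standardExps
      (Ideal.span ((fun b => monomial b (1 : K)) '' A))) e).ncard) :
    (l : ℝ) ≤ deg (Ideal.span ((fun b => monomial b (1 : K)) '' A)) := by
  obtain ⟨c, hc⟩ := eventually_ncard_slice_eq (isLowerSet_standardExps _) hn
  rw [deg_eq_of_eventually (krullDim_span_monomial hn hi) (c := c)]
  · obtain ⟨e, h1, h2⟩ := (hl.and hc).exists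
    exact_mod_cast h2 ▸ h1
  · simpa only [hilbertFn_span_monomial m] using hc

/-! ### The footprint bound -/

theorem exists_le_finrank_eq {K : Type*} [Field K] {V : Type*} [AddCommGroup V] [Module K V]
    (C : Submodule K V) [Module.Finite K C] {r : ℕ} (hr : r ≤ Module.finrank K C) :
    ∃ D ≤ C, Module.finrank K D = r := by
  let b := Module.finBasis K C
  have hli : LinearIndependent K fun i : Fin r => (b (Fin.castLE hr i) : V) :=
    (b.linearIndependent.comp _ (Fin.castLE_injective hr)).map' C.subtype C.ker_subtype
  refine ⟨Submodule.span K (Set.range fun i : Fin r => (b (Fin.castLE hr i) : V)), ?_, ?_⟩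
  · rw [Submodule.span_le]
    rintro _ ⟨i, rfl⟩
    exact (b _).2
  · rw [finrank_span_eq_card hli, Fintype.card_fin]

theorem finrank_comap_of_le_range {K : Type*} [Field K] {V W : Type*} [AddCommGroup V]
    [Module K V] [Module.Finite K V] [AddCommGroup W] [Module K W] (f : V →ₗ[K] W)
    {D : Submodule K W} (hD : D ≤ LinearMap.range f) :
    Module.finrank K (D.comap f) = Module.finrank K D + Module.finrank K (LinearMap.ker f) := by
  let g : D.comap f →ₗ[K] D := f.restrict fun x hx => hx
  have hg : Function.Surjective g := by
    rintro ⟨y, hy⟩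
    obtain ⟨x, rfl⟩ := hD hy
    exact ⟨⟨x, hy⟩, rfl⟩
  have hker : LinearMap.ker g = (LinearMap.ker f).comap (D.comap f).subtype := by
    ext x
    exact Subtype.ext_iff
  have hle : LinearMap.ker f ≤ D.comap f := fun x hx => by
    rw [Submodule.mem_comap, LinearMap.mem_ker.1 hx]
    exact zero_mem _
  rw [← LinearMap.finrank_range_add_finrank_ker g, LinearMap.range_eq_top.2 hg, finrank_top, hker,
    (Submodule.comapSubtypeEquivOfLe hle).finrank_eq]

/-- A subcode of dimension `r` provides `r` standard monomials which are leading monomials of forms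
vanishing at the points outside the support of the subcode. -/
theorem exists_standard_leadExps {s : ℕ} {K : Type*} [Field K] {ι : Type*}
    (m : MonomialOrder (Fin s)) (v : ι → Fin s → K) (hv0 : ∀ i, v i ≠ 0) (d : ℕ)
    {D : Submodule K (ι → K)} (hD : D ≤ reedMullerCode v d) :
    ∃ M : Finset (Fin s →₀ ℕ), M.card = Module.finrank K D ∧ ∀ a ∈ M, a.degree = d ∧
      monomial a (1 : K) ∉ initialIdeal m
        (vanishingIdeal (Set.range fun i => Projectivization.mk K (v i) (hv0 i))) ∧
      monomial a (1 : K) ∈ initialIdeal m (vanishingIdeal (Set.range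
        fun i : ((supp D)ᶜ : Set ι) => Projectivization.mk K (v i) (hv0 i))) := by
  set I := vanishingIdeal (Set.range fun i => Projectivization.mk K (v i) (hv0 i)) with hI
  let G : Submodule K (MvPolynomial (Fin s) K) :=
    (D.comap (evalMap v d)).map (homogeneousSubmodule (Fin s) K d).subtype
  have hGd : G ≤ homogeneousSubmodule (Fin s) K d := Submodule.map_subtype_le _ _
  have hId : gradedPiece I d =
      (LinearMap.ker (evalMap v d)).map (homogeneousSubmodule (Fin s) K d).subtype := by
    rw [ker_evalMap v hv0, Submodule.map_comap_subtype, gradedPiece]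
  have hIG : gradedPiece I d ≤ G := by
    rw [hId]
    refine Submodule.map_mono fun x hx => ?_
    rw [Submodule.mem_comap, LinearMap.mem_ker.1 hx]
    exact zero_mem _
  have hrank : Module.finrank K G = Module.finrank K D + Module.finrank K (gradedPiece I d) := by
    rw [hId, Submodule.finrank_map_subtype_eq, Submodule.finrank_map_subtype_eq,
      finrank_comap_of_le_range _ hD]
  rw [← ncard_leadExps m hGd, ← ncard_leadExps m (U := gradedPiece I d) inf_le_left] at hrank
  have hsub : leadExps m (gradedPiece I d) ⊆ leadExps m G := fun a ⟨f, hf, h⟩ => ⟨f, hIG hf, h⟩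
  have hcard := Set.ncard_sdiff_add_ncard_of_subset hsub (leadExps_finite m hGd)
  -- Leading exponents of `G` that are not leading exponents of `I_d`: their number is `dim G - dim
  -- I_d = dim D`.
  have hfin : (leadExps m G \ leadExps m (gradedPiece I d)).Finite :=
    (leadExps_finite m hGd).sdiff
  refine ⟨hfin.toFinset, ?_, ?_⟩
  · rw [← Set.ncard_eq_toFinset_card _ hfin]
    omega
  · intro a ha
    rw [Set.Finite.mem_toFinset] at ha
    obtain ⟨⟨f, hf, h0, rfl⟩, hnot⟩ := ha
    have hdeg := degree_leadingExp m (hGd hf) h0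
    refine ⟨hdeg, fun h => hnot ?_, (monomial_mem_initialIdeal_iff m).2 ⟨f, ?_, h0, le_rfl⟩⟩
    · rw [leadExps_gradedPiece m fun f hf n => homogeneousComponent_mem_vanishingIdeal _ hf n]
      exact ⟨hdeg, h⟩
    · refine (mem_vanishingIdeal_range_iff (fun i : ((supp D)ᶜ : Set ι) => v i)
        (fun i => hv0 i) (hGd hf)).2 fun i => ?_
      obtain ⟨g, hg, rfl⟩ := hf
      by_contra hne
      exact i.2 ⟨_, hg, hne⟩

/-- The monomial with exponent `u` lies in the colon ideal but not in `L`. -/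
theorem colon_ne_of_add_notMem {s : ℕ} {K : Type*} [Field K]
    {L : Ideal (MvPolynomial (Fin s) K)} {M : Finset (Fin s →₀ ℕ)} {u : Fin s →₀ ℕ}
    (hu : u ∈ standardExps L) (huM : ∀ a ∈ M, u + a ∉ standardExps L) :
    L.colon (monomialIdeal K M : Set (MvPolynomial (Fin s) K)) ≠ L := by
  intro h
  refine hu ?_
  rw [← h, Submodule.mem_colon]
  have hle : monomialIdeal K M ≤ Submodule.comap (LinearMap.lsmul _ _ (monomial u (1 : K))) L := by
    refine Ideal.span_le.2 ?_
    rintro _ ⟨a, ha, rfl⟩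
    have := huM a ha
    simp only [standardExps, Set.mem_ofPred_eq, not_not] at this
    simpa [monomial_mul] using this
  exact fun p hp => hle hp

theorem initialIdeal_sup_monomialIdeal {s : ℕ} {K : Type*} [Field K] (m : MonomialOrder (Fin s))
    (I : Ideal (MvPolynomial (Fin s) K)) (M : Finset (Fin s →₀ ℕ)) :
    initialIdeal m I ⊔ monomialIdeal K M = Ideal.span ((fun b => monomial b (1 : K)) ''
      (leadExps m (I.restrictScalars K) ∪ (M : Set (Fin s →₀ ℕ)))) := by
  rw [initialIdeal_eq_span, monomialIdeal, Set.image_union, Ideal.span_union]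

theorem standardExps_anti {s : ℕ} {K : Type*} [Field K] {I J : Ideal (MvPolynomial (Fin s) K)}
    (h : I ≤ J) : standardExps J ⊆ standardExps I :=
  fun _ ha hI => ha (h hI)

theorem ncard_slice_standardExps_le {s : ℕ} {K : Type*} [Field K] {ι : Type*} [Fintype ι]
    (m : MonomialOrder (Fin s)) (v : ι → Fin s → K) (hv0 : ∀ i, v i ≠ 0)
    {L : Ideal (MvPolynomial (Fin s) K)} (hL : initialIdeal m (vanishingIdeal
      (Set.range fun i => Projectivization.mk K (v i) (hv0 i))) ≤ L) (e : ℕ) :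
    (slice (standardExps L) e).ncard ≤ Fintype.card ι := by
  refine (Set.ncard_le_ncard (slice_mono (standardExps_anti hL) e) (slice_finite _ e)).trans ?_
  rw [← hilbertFn_eq_ncard_footprint m
    fun f hf n => homogeneousComponent_mem_vanishingIdeal _ hf n]
  exact hilbertFn_vanishingIdeal_le v hv0 e

/-- Every subcode whose support is not everything yields a member `M` of the family defining the
footprint function, and the degree of `S/(in(I), M)` bounds the number of common zeros. -/
theorem exists_mem_footprintSets {s : ℕ} {K : Type*} [Field K] {ι : Type*} [Fintype ι]
    (m : MonomialOrder (Fin s)) (v : ι → Fin s → K) (hv0 : ∀ i, v i ≠ 0)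
    (hinj : Function.Injective fun i => Projectivization.mk K (v i) (hv0 i)) (d : ℕ)
    {D : Submodule K (ι → K)} (hD : D ≤ reedMullerCode v d) (hV : (supp D)ᶜ.Nonempty) :
    ∃ M ∈ footprintSets m (vanishingIdeal
        (Set.range fun i => Projectivization.mk K (v i) (hv0 i))) d (Module.finrank K D),
      ((supp D)ᶜ.ncard : ℝ) ≤ deg (initialIdeal m (vanishingIdeal
        (Set.range fun i => Projectivization.mk K (v i) (hv0 i))) ⊔ monomialIdeal K M) := by
  classical
  obtain ⟨M, hMr, hM⟩ := exists_standard_leadExps m v hv0 d hD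
  set I := vanishingIdeal (Set.range fun i => Projectivization.mk K (v i) (hv0 i)) with hI
  set J := vanishingIdeal (Set.range
    fun i : ((supp D)ᶜ : Set ι) => Projectivization.mk K (v i) (hv0 i)) with hJ
  have hIJ : I ≤ J := vanishingIdeal_anti (by rintro _ ⟨i, rfl⟩; exact ⟨i, rfl⟩)
  have hle : initialIdeal m I ⊔ monomialIdeal K M ≤ initialIdeal m J := by
    refine sup_le (initialIdeal_mono m hIJ) (Ideal.span_le.2 ?_)
    rintro _ ⟨a, ha, rfl⟩
    exact (hM a ha).2.2
  have hcount : ∀ᶠ e in Filter.atTop, (supp D)ᶜ.ncard ≤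
      (slice (standardExps (initialIdeal m I ⊔ monomialIdeal K M)) e).ncard := by
    filter_upwards [Filter.eventually_ge_atTop (Fintype.card ((supp D)ᶜ : Set ι))] with e he
    have h1 := hilbertFn_vanishingIdeal (fun i : ((supp D)ᶜ : Set ι) => v i) (fun i => hv0 i)
      (fun i j h => Subtype.ext (hinj h)) he
    rw [hilbertFn_eq_ncard_footprint m
      fun f hf n => homogeneousComponent_mem_vanishingIdeal _ hf n] at h1
    rw [← Nat.card_coe_set_eq, Nat.card_eq_fintype_card, ← h1]
    exact Set.ncard_le_ncard (slice_mono (standardExps_anti hle) e) (slice_finite _ e)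
  have hpos : 0 < (supp D)ᶜ.ncard := (Set.ncard_pos (Set.toFinite _)).2 hV
  -- The axis is chosen for the larger ideal `(in(I), M)`. It is then also standard for `in(I)`, and
  -- no element of `M` divides a power of its variable.
  obtain ⟨i, hi⟩ := exists_forall_single_mem (isLowerSet_standardExps _)
    (hcount.mono fun e he => Set.nonempty_of_ncard_ne_zero (hpos.trans_le he).ne')
  have hmM : ∀ a ∈ M, monomial a (1 : K) ∈ initialIdeal m I ⊔ monomialIdeal K M := fun a ha =>
    Ideal.mem_sup_right (Ideal.subset_span ⟨a, ha, rfl⟩)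
  obtain ⟨u, hu, huM⟩ := exists_add_notMem (isLowerSet_standardExps (initialIdeal m I))
    (ncard_slice_standardExps_le m v hv0 le_rfl)
    (fun k => standardExps_anti le_sup_left (hi k)) M
    (fun a ha k hak => isLowerSet_standardExps _ hak (hi k) (hmM a ha))
  refine ⟨M, ⟨hMr, fun a ha => ⟨(hM a ha).2.1, (hM a ha).1⟩, colon_ne_of_add_notMem hu huM⟩, ?_⟩
  have hbound := ncard_slice_standardExps_le m v hv0
    (le_sup_left : initialIdeal m I ≤ initialIdeal m I ⊔ monomialIdeal K M)
  rw [initialIdeal_sup_monomialIdeal] at hi hcount hbound ⊢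
  exact le_deg_span_monomial m hbound hi hcount

theorem fp_le_genHammingWeight {s : ℕ} {K : Type*} [Field K] {ι : Type*} [Fintype ι] [Nonempty ι]
    (m : MonomialOrder (Fin s)) (v : ι → Fin s → K) (hv0 : ∀ i, v i ≠ 0)
    (hinj : Function.Injective fun i => Projectivization.mk K (v i) (hv0 i)) (d r : ℕ)
    (hr : r ≤ hilbertFn
      (vanishingIdeal (Set.range fun i => Projectivization.mk K (v i) (hv0 i))) d) :
    fp m (vanishingIdeal (Set.range fun i => Projectivization.mk K (v i) (hv0 i))) d r ≤
      (genHammingWeight (reedMullerCode v d) r : ℝ) := by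
  rw [hilbertFn_vanishingIdeal_eq_finrank] at hr
  obtain ⟨D₀, hD₀, hr₀⟩ := exists_le_finrank_eq _ hr
  -- The set of weights is nonempty by the choice of `r`, so its infimum is attained by some `D`.
  obtain ⟨D, hD, rfl, hw⟩ := Nat.sInf_mem (s := {n | ∃ D : Submodule K (ι → K),
    D ≤ reedMullerCode v d ∧ Module.finrank K D = r ∧ (supp D).ncard = n}) ⟨_, D₀, hD₀, hr₀, rfl⟩
  rw [genHammingWeight, ← hw, fp, deg_vanishingIdeal v hv0 hinj]
  have hcard : ((supp D).ncard : ℝ) + ((supp D)ᶜ.ncard : ℝ) = Fintype.card ι := by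
    have := Set.ncard_add_ncard_compl (supp D)
    rw [Nat.card_eq_fintype_card] at this
    exact_mod_cast this
  have hbdd := ((footprintSets_finite m (vanishingIdeal
    (Set.range fun i => Projectivization.mk K (v i) (hv0 i))) d (Module.finrank K D)).image
      fun M => deg (initialIdeal m (vanishingIdeal
        (Set.range fun i => Projectivization.mk K (v i) (hv0 i))) ⊔ monomialIdeal K M)).bddAbove
  split_ifs with hne
  · obtain ⟨M, hM, hle⟩ : ∃ M ∈ footprintSets m (vanishingIdeal
        (Set.range fun i => Projectivization.mk K (v i) (hv0 i))) d (Module.finrank K D),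
        ((supp D)ᶜ.ncard : ℝ) ≤ deg (initialIdeal m (vanishingIdeal
          (Set.range fun i => Projectivization.mk K (v i) (hv0 i))) ⊔ monomialIdeal K M) := by
      -- With full support any member of the family will do, since the bound required of it is `0`.
      by_cases hV : (supp D)ᶜ.Nonempty
      · exact exists_mem_footprintSets m v hv0 hinj d hD hV
      · obtain ⟨M, hM⟩ := hne
        refine ⟨M, hM, ?_⟩
        rw [Set.not_nonempty_iff_eq_empty.1 hV, Set.ncard_empty, Nat.cast_zero]
        have hbound := ncard_slice_standardExps_le m v hv0
          (le_sup_left : _ ≤ _ ⊔ monomialIdeal K M)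
        rw [initialIdeal_sup_monomialIdeal] at hbound ⊢
        exact deg_span_monomial_nonneg m hbound
    have := le_csSup hbdd ⟨M, hM, rfl⟩
    linarith
  -- An empty family forces full support, and then the weight is `|X| = deg(S/I)`.
  · have hV : (supp D)ᶜ = ∅ := by
      by_contra hV
      obtain ⟨M, hM, -⟩ := exists_mem_footprintSets m v hv0 hinj d hD
        (Set.nonempty_iff_ne_empty.2 hV)
      exact hne ⟨M, hM⟩
    rw [hV, Set.ncard_empty, Nat.cast_zero, add_zero] at hcard
    exact hcard.ge

end FootprintBound

end

theorem mainTheorem2 {s : ℕ} {K : Type*} [Field K] (m : MonomialOrder (Fin s))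
    (X : Finset (Projectivization K (Fin s → K))) (hX : 2 ≤ X.card)
    (v : X → Fin s → K) (hv0 : ∀ P : X, v P ≠ 0)
    (hv : ∀ P : X, Projectivization.mk K (v P) (hv0 P) = (P : Projectivization K (Fin s → K)))
    (d r : ℕ) (hd : 1 ≤ d) (hr : 1 ≤ r)
    (hrH : r ≤ FootprintBound.hilbertFn
      (FootprintBound.vanishingIdeal (X : Set (Projectivization K (Fin s → K)))) d) :
    FootprintBound.fp m
        (FootprintBound.vanishingIdeal (X : Set (Projectivization K (Fin s → K)))) d r ≤
      (FootprintBound.genHammingWeight (FootprintBound.reedMullerCode v d) r : ℝ) := by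
  have hrange : (X : Set (Projectivization K (Fin s → K))) =
      Set.range fun P : X => Projectivization.mk K (v P) (hv0 P) := by
    simp only [hv]
    exact Subtype.range_coe.symm
  have : Nonempty X := (Finset.card_pos.1 (by omega : 0 < X.card)).to_subtype
  rw [hrange] at hrH ⊢
  refine FootprintBound.fp_le_genHammingWeight m v hv0 (fun P Q h => Subtype.ext ?_) d r hrH
  simpa only [hv] using h
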